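/- For an integer $q\ge 1$ let $\mathbb T_q$ be a $(q+1)$-regular tree with adjacency operator $A$, acting on finitely supported functions on the vertices by $(Af)(v)=\sum_{w\sim v}f(w)$, and let $o$ be a vertex of $\mathbb T_q$. There is a unique Borel probability measure $\mu_q$ on $\mathbb R$ with bounded support (the Kesten–McKay distribution, i.e. the normalized spectral measure of $\mathbb T_q$) such that $$\int_{\mathbb R}P\,d\mu_q=\langle \mathbf 1_o,\,P(q^{-1/2}A)\,\mathbf 1_o\rangle\qquad\text{for every polynomial }P\in\mathbb R[x].$$ Let $\mu_\infty$ be the semicircle law, $d\mu_\infty(x)=\frac1{2\pi}\sqrt{4-x^2}\,\mathbf 1_{|x|\le 2}\,dx$. Let $P_\infty(\mathbb R)$ be the set of Borel probability measures on $\mathbb R$ with bounded support, with the distance $$W_\infty(\mu,\nu)=\inf_{\gamma\in\Pi(\mu,\nu)}\|x-y\|_{L^\infty(\mathbb R^2,\gamma)},$$ where $\Pi(\mu,\nu)$ is the set of couplings of $\mu$ and $\nu$, and for a probability measure $\mu$ on $\mathbb R$ let $F_\mu^{-1}(x)=\inf\{y\in\mathbb R : \mu((-\infty,y])\ge x\}$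 for $x\in(0,1)$. Then, as $q\to\infty$ through the integers: (i) $\mu_q\to\mu_\infty$ in $P_\infty(\mathbb R)$, that is, all these measures lie in $P_\infty(\mathbb R)$ and $W_\infty(\mu_q,\mu_\infty)\to 0$; (ii) $F_{\mu_q}^{-1}\to F_{\mu_\infty}^{-1}$ uniformly on $(0,1)$. -/

import Mathlib

open MeasureTheory Filter Topology

noncomputable section

/-- The adjacency operator of a locally finite graph, acting on finitely supported real functions
on the vertices. It sends the indicator `𝟏_v` to the sum of the indicators of the neighbours of
`v`; equivalently `(A f)(v) = ∑_{w ∼ v} f(w)`. -/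
def adjOperator {V : Type*} (G : SimpleGraph V) [G.LocallyFinite] : Module.End ℝ (V →₀ ℝ) :=
  Finsupp.linearCombination ℝ fun v => ∑ w ∈ G.neighborFinset v, Finsupp.single w (1 : ℝ)

/-- The number `⟨𝟏_o, P(q^{-1/2} A) 𝟏_o⟩`, where `A` is the adjacency operator of `G`. Pairing a
function with the indicator `𝟏_o` is evaluating it at `o`. -/
def vertexState {V : Type*} (G : SimpleGraph V) [G.LocallyFinite] (q : ℕ) (o : V)
    (P : Polynomial ℝ) : ℝ :=
  (Polynomial.aeval ((Real.sqrt q)⁻¹ • adjOperator G) P) (Finsupp.single o 1) o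

/-- `P_∞(ℝ)`: the Borel probability measures on `ℝ` with bounded support. -/
def BoundedProb : Set (Measure ℝ) :=
  {μ | IsProbabilityMeasure μ ∧ Bornology.IsBounded μ.support}

/-- `μ` is a normalized spectral measure of the (`(q+1)`-regular) graph `G` at the vertex `o`: a
probability measure of bounded support with `∫ P dμ = ⟨𝟏_o, P(q^{-1/2} A) 𝟏_o⟩` for every
polynomial `P`. -/
def IsSpectralMeasure {V : Type*} (G : SimpleGraph V) [G.LocallyFinite] (q : ℕ) (o : V)
    (μ : Measure ℝ) : Prop :=
  μ ∈ BoundedProb ∧ ∀ P : Polynomial ℝ, ∫ x, P.eval x ∂μ = vertexState G q o P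

open Classical in
/-- The normalized spectral measure of the (`(q+1)`-regular) graph `G` at the vertex `o`
(with the default value `0` if there is none). -/
def spectralMeasure {V : Type*} (G : SimpleGraph V) [G.LocallyFinite] (q : ℕ) (o : V) :
    Measure ℝ :=
  if h : ∃ μ : Measure ℝ, IsSpectralMeasure G q o μ then h.choose else 0

/-- The Wigner semicircle law `μ_∞`, with density `(2π)⁻¹ √(4 - x²)` on `[-2, 2]`. -/
def semicircleLaw : Measure ℝ :=
  volume.withDensity fun x => ENNReal.ofReal
    ((Set.Icc (-2 : ℝ) 2).indicator (fun x => 1 / (2 * Real.pi) * Real.sqrt (4 - x ^ 2)) x)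

/-- The set `Π(μ, ν)` of couplings of `μ` and `ν`: measures on the plane with marginals
`μ` and `ν`. -/
def couplings (μ ν : Measure ℝ) : Set (Measure (ℝ × ℝ)) :=
  {γ | γ.map Prod.fst = μ ∧ γ.map Prod.snd = ν}

/-- The `∞`-Wasserstein distance `W_∞(μ, ν) = inf_{γ ∈ Π(μ, ν)} ‖x - y‖_{L^∞(γ)}`, with values
in `[0, ∞]`. -/
def wassersteinInfty (μ ν : Measure ℝ) : ENNReal :=
  ⨅ γ ∈ couplings μ ν, eLpNorm (fun z : ℝ × ℝ => z.1 - z.2) ⊤ γ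

/-- The generalized inverse distribution function
`F_μ⁻¹(x) = inf {y | μ((-∞, y]) ≥ x}`. -/
def inverseDistribution (μ : Measure ℝ) (x : ℝ) : ℝ :=
  sInf {y : ℝ | x ≤ μ.real (Set.Iic y)}

end

/-! Evaluated at `q^{-1/2} A`, the polynomial `sphericalPoly q n` sends `𝟏_o` to `q^{-n/2}` times
the indicator of the sphere of radius `n` about `o` (`aeval_sphericalPoly_apply`). The functional
defining `μ_q` is therefore 1 on the polynomial with `n = 0` and 0 on all the others. These
polynomials span `ℝ[X]`, and moments determine a measure of bounded support, so `μ_q` is identified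
by exhibiting one measure with these integrals. For `q ≥ 2` it is the semicircle law times
`(q+1)/((q+1)²/q - x²)`; for `q = 1` it is the arcsine law.

That density is `1 + O(1/q)` uniformly on `[-2, 2]`, so the distribution functions of `μ_q` and
`μ_∞` differ by at most `20/q`. Weak closeness alone would not control `W_∞`. What does is that both
measures live on `[-2, 2]` and that the semicircle law gives every subinterval of length `δ` mass at
least some `m(δ) > 0`. Once `20/q < m(δ)`, the quantile functions differ by at most `δ`
(`abs_inverseDistribution_sub_le`). This is (ii), and the quantile coupling turns it into (i). -/

/-! ### Spheres in a regular tree -/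

theorem adjOperator_apply {V : Type*} (G : SimpleGraph V) [G.LocallyFinite] (f : V →₀ ℝ) (v : V) :
    adjOperator G f v = ∑ w ∈ G.neighborFinset v, f w := by
  classical
  induction f using Finsupp.induction_linear with
  | zero => simp
  | add f g hf hg => simp [hf, hg, Finset.sum_add_distrib]
  | single a b =>
    simp only [adjOperator, Finsupp.linearCombination_single, Finsupp.smul_apply,
      Finsupp.finsetSum_apply, Finsupp.single_apply, Finset.sum_ite_eq', smul_eq_mul,
      SimpleGraph.mem_neighborFinset, Finset.sum_ite_eq, G.adj_comm a v]
    split_ifs <;> simp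

namespace SimpleGraph.IsTree

variable {V : Type*} {G : SimpleGraph V}

/-- Geodesics from `o` to `w` and to `w'`, each extended by the edge to `v`, are both paths. Paths
in a tree are unique, so their penultimate vertices agree. -/
theorem eq_of_adj_of_dist_eq (hG : G.IsTree) {o v w w' : V} (hw : G.Adj v w) (hw' : G.Adj v w')
    (hd : G.dist o v = G.dist o w + 1) (hd' : G.dist o v = G.dist o w' + 1) : w = w' := by
  obtain ⟨p, hp, hl⟩ := (hG.connected o w).exists_path_of_dist
  obtain ⟨p', hp', hl'⟩ := (hG.connected o w').exists_path_of_dist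
  have key : ∀ {u : V} (r : G.Walk o u) (hu : G.Adj v u), r.length = G.dist o u →
      G.dist o v = G.dist o u + 1 → (r.concat hu.symm).IsPath := by
    intro u r hu hr hd
    apply SimpleGraph.Walk.isPath_of_length_eq_dist
    rw [SimpleGraph.Walk.length_concat, hr, hd]
  have := hG.existsUnique_path o v |>.unique (key p hw hl hd) (key p' hw' hl' hd')
  have h2 := congrArg SimpleGraph.Walk.penultimate this
  simpa using h2

theorem card_neighborFinset_dist_succ [G.LocallyFinite] (hG : G.IsTree) {o v : V}
    (hv : v ≠ o) : ((G.neighborFinset v).filter fun w => G.dist o v = G.dist o w + 1).card = 1 := by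
  obtain ⟨p, hp⟩ := (hG.connected o v).exists_walk_length_eq_dist
  have hn : ¬ p.Nil := fun h => hv h.eq.symm
  rw [Finset.card_eq_one]
  refine ⟨p.penultimate, Finset.ext fun w => ?_⟩
  have h1 : G.Adj v p.penultimate := (p.adj_penultimate hn).symm
  have h2 : G.dist o v = G.dist o p.penultimate + 1 := by
    have h3 : G.dist o p.penultimate ≤ p.dropLast.length := SimpleGraph.dist_le _
    have h4 := SimpleGraph.Walk.length_dropLast_add_one hn
    rcases hG.dist_eq_dist_add_one_of_adj o h1 with h | h <;> omega
  simp only [Finset.mem_filter, SimpleGraph.mem_neighborFinset, Finset.mem_singleton]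
  constructor
  · rintro ⟨ha, hd⟩
    exact hG.eq_of_adj_of_dist_eq ha h1 hd h2
  · rintro rfl
    exact ⟨h1, h2⟩

theorem card_neighborFinset_dist_pred [G.LocallyFinite] (hG : G.IsTree) {q : ℕ}
    (hreg : G.IsRegularOfDegree (q + 1)) {o v : V} (hv : v ≠ o) :
    ((G.neighborFinset v).filter fun w => G.dist o w = G.dist o v + 1).card = q := by
  have h := Finset.card_filter_add_card_filter_not (s := G.neighborFinset v)
    (fun w => G.dist o v = G.dist o w + 1)
  rw [hG.card_neighborFinset_dist_succ hv, G.card_neighborFinset_eq_degree, hreg v] at h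
  rw [← Nat.add_left_cancel (h.trans (add_comm q 1))]
  congr 1
  refine Finset.filter_congr fun w hw => ?_
  rw [SimpleGraph.mem_neighborFinset] at hw
  rcases hG.dist_eq_dist_add_one_of_adj o hw with h | h <;> omega

/-- This computes `A` on the indicator of a sphere. A vertex other than `o` has one neighbour closer
to `o` and `q` farther away; all `q + 1` neighbours of `o` are farther, whence the exception at `n =
1`. -/
theorem sum_neighborFinset_dist_eq [G.LocallyFinite] (hG : G.IsTree) {q : ℕ}
    (hreg : G.IsRegularOfDegree (q + 1)) (o v : V) (n : ℕ) :
    ∑ w ∈ G.neighborFinset v, (if G.dist o w = n then (1 : ℝ) else 0) =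
      (if G.dist o v = n + 1 then 1 else 0) +
        (if G.dist o v + 1 = n then if n = 1 then (q + 1 : ℝ) else q else 0) := by
  rw [Finset.sum_boole]
  by_cases hv : v = o
  · subst hv
    have hd : ∀ w ∈ G.neighborFinset v, G.dist v w = 1 := fun w hw => by
      rwa [SimpleGraph.dist_eq_one_iff_adj, ← SimpleGraph.mem_neighborFinset]
    by_cases hn : n = 1
    · subst hn
      rw [Finset.filter_true_of_mem hd, G.card_neighborFinset_eq_degree, hreg v]
      simp
    · rw [Finset.filter_false_of_mem fun w hw => by rw [hd w hw]; omega]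
      simp [hn, eq_comm]
  · have h0 : G.dist o v ≠ 0 := fun h => hv ((hG.connected o v).dist_eq_zero_iff.1 h).symm
    by_cases h1 : G.dist o v = n + 1
    · have := hG.card_neighborFinset_dist_succ hv
      rw [h1] at this
      simp only [add_left_inj] at this
      simp_rw [eq_comm (a := n)] at this
      rw [this, if_pos h1, if_neg (by omega)]
      simp
    · by_cases h2 : G.dist o v + 1 = n
      · have := hG.card_neighborFinset_dist_pred hreg hv
        rw [h2] at this
        rw [this, if_neg h1, if_pos h2, if_neg (by omega), zero_add]
      · rw [Finset.filter_false_of_mem, if_neg h1, if_neg h2]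
        · simp
        · intro w hw
          rw [SimpleGraph.mem_neighborFinset] at hw
          rcases hG.dist_eq_dist_add_one_of_adj o hw with h | h <;> omega

end SimpleGraph.IsTree

/-! ### Spherical polynomials and the vertex state -/

/-- The orthogonal polynomials of the Kesten–McKay distribution: `1` and, for `n ≥ 1`,
`S_n - q⁻¹ S_{n-2}`, where the `S_n` are the rescaled Chebyshev polynomials of the second kind. -/
noncomputable def sphericalPoly (q : ℕ) : ℕ → Polynomial ℝ
  | 0 => 1
  | n + 1 => Polynomial.Chebyshev.S ℝ (n + 1) -
      Polynomial.C (q : ℝ)⁻¹ * Polynomial.Chebyshev.S ℝ (n - 1)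

theorem sphericalPoly_one (q : ℕ) : sphericalPoly q 1 = Polynomial.X := by
  simp [sphericalPoly]

theorem X_mul_sphericalPoly_one (q : ℕ) :
    Polynomial.X * sphericalPoly q 1 =
      sphericalPoly q 2 + (1 + (q : ℝ)⁻¹) • sphericalPoly q 0 := by
  simp only [sphericalPoly, Polynomial.smul_eq_C_mul]
  norm_num [Polynomial.Chebyshev.S_two]
  ring

theorem X_mul_sphericalPoly_add_two (q n : ℕ) :
    Polynomial.X * sphericalPoly q (n + 2) = sphericalPoly q (n + 3) + sphericalPoly q (n + 1) := by
  simp only [sphericalPoly]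
  have h1 := Polynomial.Chebyshev.S_add_two ℝ (n + 1)
  have h2 := Polynomial.Chebyshev.S_add_two ℝ (n - 1)
  push_cast
  rw [show (n : ℤ) + 2 + 1 = n + 1 + 2 by ring, h1, show (n : ℤ) + 2 - 1 = n - 1 + 2 by ring, h2,
    show (n : ℤ) + 1 - 1 = n - 1 + 1 by ring]
  ring

/-- A linear functional on polynomials is determined by its values on the `sphericalPoly q n`. -/
theorem linearMap_ext_sphericalPoly (q : ℕ) {M : Type*} [AddCommGroup M] [Module ℝ M]
    {f g : Polynomial ℝ →ₗ[ℝ] M} (h : ∀ n, f (sphericalPoly q n) = g (sphericalPoly q n)) :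
    f = g := by
  -- Induction on `k` for all `m` at once: the three-term relations absorb one factor `X` into
  -- `sphericalPoly q m`. Taking `m = 0` gives the monomials.
  have key : ∀ k m, f (Polynomial.X ^ k * sphericalPoly q m) =
      g (Polynomial.X ^ k * sphericalPoly q m) := by
    intro k
    induction k with
    | zero => simpa using h
    | succ k ih =>
      intro m
      rw [pow_succ, mul_assoc]
      match m with
      | 0 => simpa [sphericalPoly_one, sphericalPoly] using ih 1
      | 1 =>
        rw [X_mul_sphericalPoly_one, mul_add, map_add, map_add, ih, mul_smul_comm,
          map_smul, map_smul, ih]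
      | m + 2 => rw [X_mul_sphericalPoly_add_two, mul_add, map_add, map_add, ih, ih]
  refine Polynomial.lhom_ext' fun n => LinearMap.ext fun a => ?_
  have := key n 0
  simp only [sphericalPoly, mul_one] at this
  simp [← Polynomial.C_mul_X_pow_eq_monomial, ← Polynomial.smul_eq_C_mul, this]

theorem aeval_sphericalPoly_apply {V : Type*} {G : SimpleGraph V} [G.LocallyFinite]
    (hG : G.IsTree) {q : ℕ} (hq : 1 ≤ q) (hreg : G.IsRegularOfDegree (q + 1)) (o : V) (n : ℕ)
    (v : V) :
    (Polynomial.aeval ((Real.sqrt q)⁻¹ • adjOperator G) (sphericalPoly q n))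
      (Finsupp.single o 1) v = ((Real.sqrt q)⁻¹) ^ n * if G.dist o v = n then 1 else 0 := by
  classical
  set s := (Real.sqrt q)⁻¹ with hs
  have hq0 : (0 : ℝ) < q := by exact_mod_cast hq
  have hs2 : s ^ 2 * q = 1 := by
    rw [hs, inv_pow, Real.sq_sqrt hq0.le, inv_mul_cancel₀ hq0.ne']
  have hs3 : s ^ 2 = (q : ℝ)⁻¹ := by rw [hs, inv_pow, Real.sq_sqrt hq0.le]
  set Φ : ℕ → V →₀ ℝ := fun n => (Polynomial.aeval (s • adjOperator G) (sphericalPoly q n))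
      (Finsupp.single o 1) with hΦ
  have hstep : ∀ n, (∀ v, Φ n v = s ^ n * if G.dist o v = n then 1 else 0) → ∀ v,
      (Polynomial.aeval (s • adjOperator G) (Polynomial.X * sphericalPoly q n))
        (Finsupp.single o 1) v = s ^ (n + 1) * ((if G.dist o v = n + 1 then 1 else 0) +
        (if G.dist o v + 1 = n then if n = 1 then (q + 1 : ℝ) else q else 0)) := by
    intro n hn v
    rw [map_mul, Polynomial.aeval_X, Module.End.mul_apply, LinearMap.smul_apply,
      Finsupp.smul_apply, adjOperator_apply, smul_eq_mul]
    rw [Finset.sum_congr rfl fun w _ => hn w, ← Finset.mul_sum,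
      hG.sum_neighborFinset_dist_eq hreg]
    ring
  have h0 : ∀ v, Φ 0 v = s ^ 0 * if G.dist o v = 0 then 1 else 0 := by
    intro v
    simp [hΦ, sphericalPoly, Finsupp.single_apply, (hG.connected o v).dist_eq_zero_iff]
  have h1 : ∀ v, Φ 1 v = s ^ 1 * if G.dist o v = 1 then 1 else 0 := by
    intro v
    have := hstep 0 h0 v
    simpa [sphericalPoly, hΦ] using this
  -- The recurrence has order two, so two consecutive spheres are carried along. The step from 1 to
  -- 2 is separate because of the extra neighbour of `o`, matched by the coefficient `1 + q⁻¹`.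
  have h2 : ∀ n, (∀ v, Φ (n + 1) v = s ^ (n + 1) * if G.dist o v = n + 1 then 1 else 0) ∧
      (∀ v, Φ (n + 2) v = s ^ (n + 2) * if G.dist o v = n + 2 then 1 else 0) := by
    intro n
    induction n with
    | zero =>
      refine ⟨h1, fun v => ?_⟩
      have := hstep 1 h1 v
      rw [X_mul_sphericalPoly_one, map_add, LinearMap.add_apply, Finsupp.add_apply,
        map_smul, LinearMap.smul_apply, Finsupp.smul_apply] at this
      change Φ 2 v + (1 + (q : ℝ)⁻¹) * Φ 0 v = _ at this
      rw [h0, if_pos rfl, ← hs3] at this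
      simp only [add_eq_right] at this
      simp only [zero_add]
      split_ifs at this ⊢ <;>
        first | linear_combination this | linear_combination this + hs2
    | succ n ih =>
      refine ⟨ih.2, fun v => ?_⟩
      have := hstep (n + 2) ih.2 v
      rw [X_mul_sphericalPoly_add_two, map_add, LinearMap.add_apply, Finsupp.add_apply] at this
      change Φ (n + 3) v + Φ (n + 1) v = _ at this
      rw [ih.1, if_neg (by omega : n + 2 ≠ 1)] at this
      simp only [show ∀ a, a + 1 = n + 2 ↔ a = n + 1 by omega] at this
      change Φ (n + 3) v = s ^ (n + 3) * if G.dist o v = n + 3 then 1 else 0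
      split_ifs at this ⊢ <;>
        first | linear_combination this | linear_combination this + s ^ (n + 1) * hs2
  match n with
  | 0 => exact h0 v
  | n + 1 => exact (h2 n).1 v

theorem vertexState_sphericalPoly {V : Type*} {G : SimpleGraph V} [G.LocallyFinite]
    (hG : G.IsTree) {q : ℕ} (hq : 1 ≤ q) (hreg : G.IsRegularOfDegree (q + 1)) (o : V) (n : ℕ) :
    vertexState G q o (sphericalPoly q n) = if n = 0 then 1 else 0 := by
  rw [vertexState, aeval_sphericalPoly_apply hG hq hreg]
  rcases n with _ | n <;> simp

/-- `vertexState` as a linear functional. -/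
noncomputable def vertexStateₗ {V : Type*} (G : SimpleGraph V) [G.LocallyFinite] (q : ℕ) (o : V) :
    Polynomial ℝ →ₗ[ℝ] ℝ where
  toFun := vertexState G q o
  map_add' P Q := by simp [vertexState]
  map_smul' c P := by simp [vertexState]

/-! ### The semicircle law and Chebyshev orthogonality -/

theorem measurable_semicircle_density : Measurable
    ((Set.Icc (-2 : ℝ) 2).indicator fun x => 1 / (2 * Real.pi) * Real.sqrt (4 - x ^ 2)) := by
  refine Measurable.indicator ?_ measurableSet_Icc
  fun_prop

theorem semicircle_density_nonneg (x : ℝ) :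
    0 ≤ (Set.Icc (-2 : ℝ) 2).indicator (fun x => 1 / (2 * Real.pi) * Real.sqrt (4 - x ^ 2)) x :=
  Set.indicator_nonneg (fun x _ => by positivity) x

instance : IsFiniteMeasure semicircleLaw := by
  refine isFiniteMeasure_withDensity_ofReal (Integrable.hasFiniteIntegral ?_)
  rw [integrable_indicator_iff measurableSet_Icc]
  exact ContinuousOn.integrableOn_compact isCompact_Icc (by fun_prop)

theorem semicircleLaw_ae_mem_Icc : ∀ᵐ x ∂semicircleLaw, x ∈ Set.Icc (-2 : ℝ) 2 := by
  rw [semicircleLaw, ae_withDensity_iff measurable_semicircle_density.ennreal_ofReal]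
  refine Eventually.of_forall fun x hx => ?_
  by_contra h
  exact hx (by rw [Set.indicator_of_notMem h, ENNReal.ofReal_zero])

theorem ContinuousOn.integrable_semicircleLaw {f : ℝ → ℝ}
    (hf : ContinuousOn f (Set.Icc (-2) 2)) : Integrable f semicircleLaw := by
  have := hf.integrableOn_compact (μ := semicircleLaw) isCompact_Icc
  rwa [IntegrableOn, Measure.restrict_eq_self_of_ae_mem semicircleLaw_ae_mem_Icc] at this

/-- Rescale by 2 and write `√(1-x²) = (1-x²)/√(1-x²)`: semicircle integrals become integrals against
the orthogonality measure of the `T_n`. -/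
theorem integral_semicircleLaw (f : ℝ → ℝ) :
    ∫ x, f x ∂semicircleLaw =
      2 / Real.pi * ∫ x, (1 - x ^ 2) * f (2 * x) ∂Polynomial.Chebyshev.measureT := by
  rw [Polynomial.Chebyshev.integral_measureT, semicircleLaw,
    integral_withDensity_eq_integral_toReal_smul measurable_semicircle_density.ennreal_ofReal
      (by simp)]
  simp_rw [ENNReal.toReal_ofReal (semicircle_density_nonneg _), smul_eq_mul,
    ← Set.indicator_mul_left]
  rw [integral_indicator measurableSet_Icc, integral_Icc_eq_integral_Ioc,
    ← intervalIntegral.integral_of_le (by norm_num)]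
  have h := intervalIntegral.integral_comp_mul_left (a := -1) (b := 1)
    (fun x => 1 / (2 * Real.pi) * Real.sqrt (4 - x ^ 2) * f x) (c := 2) (by norm_num)
  rw [smul_eq_mul, show (2 : ℝ) * -1 = -2 by norm_num, mul_one] at h
  have h2 : ∫ x in (-2 : ℝ)..2, 1 / (2 * Real.pi) * Real.sqrt (4 - x ^ 2) * f x =
      2 * ∫ x in (-1 : ℝ)..1, 1 / (2 * Real.pi) * Real.sqrt (4 - (2 * x) ^ 2) * f (2 * x) := by
    linear_combination -2 * h
  rw [h2, ← intervalIntegral.integral_const_mul, ← intervalIntegral.integral_const_mul]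
  refine intervalIntegral.integral_congr fun x hx => ?_
  rw [Set.uIcc_of_le (by norm_num)] at hx
  have hx2 : 0 ≤ 1 - x ^ 2 := by nlinarith [hx.1, hx.2]
  have e1 : Real.sqrt (4 - (2 * x) ^ 2) = 2 * Real.sqrt (1 - x ^ 2) := by
    rw [show 4 - (2 * x) ^ 2 = 2 ^ 2 * (1 - x ^ 2) by ring, Real.sqrt_mul (by norm_num),
      Real.sqrt_sq (by norm_num)]
  have e2 : (1 - x ^ 2) * Real.sqrt (1 - x ^ 2)⁻¹ = Real.sqrt (1 - x ^ 2) := by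
    rw [Real.sqrt_inv, ← div_eq_mul_inv, Real.div_sqrt]
  have hpi := Real.pi_ne_zero
  simp only [e1]
  rw [mul_right_comm _ (f (2 * x)), e2]
  field_simp

/-- With `x = cos θ` this is the product formula for `sin θ · sin((n+1)θ)`. -/
theorem Polynomial.Chebyshev.one_sub_sq_mul_eval_S (n : ℤ) (x : ℝ) :
    (1 - x ^ 2) * (S ℝ n).eval (2 * x) = ((T ℝ n).eval x - (T ℝ (n + 2)).eval x) / 2 := by
  have h1 := congrArg (Polynomial.eval x) (one_sub_X_sq_mul_U_eq_pol_in_T ℝ n)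
  have h2 := congrArg (Polynomial.eval x) (T_add_two ℝ n)
  have h3 := congrArg (Polynomial.eval x) (S_comp_two_mul_X ℝ n)
  simp only [eval_mul, eval_sub, eval_one, eval_pow, eval_X, eval_comp, eval_ofNat] at h1 h2 h3
  rw [h3]
  linear_combination h1 - h2 / 2

theorem integral_S_semicircleLaw {n : ℤ} (hn : 0 ≤ n) :
    ∫ x, (Polynomial.Chebyshev.S ℝ n).eval x ∂semicircleLaw = if n = 0 then 1 else 0 := by
  rw [integral_semicircleLaw]
  simp_rw [Polynomial.Chebyshev.one_sub_sq_mul_eval_S]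
  rw [integral_div, integral_sub
    (Polynomial.Chebyshev.integrable_measureT (Polynomial.continuous _).continuousOn)
    (Polynomial.Chebyshev.integrable_measureT (Polynomial.continuous _).continuousOn),
    Polynomial.Chebyshev.integral_eval_T_real_measureT_of_ne_zero (n := n + 2) (by omega)]
  have := Real.pi_ne_zero
  split_ifs with h
  · rw [h, Polynomial.Chebyshev.integral_eval_T_real_measureT_zero]
    field_simp
    simp
  · rw [Polynomial.Chebyshev.integral_eval_T_real_measureT_of_ne_zero h]
    simp

instance : IsProbabilityMeasure semicircleLaw := by
  have h := integral_S_semicircleLaw le_rfl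
  simp only [Polynomial.Chebyshev.S_zero, Polynomial.eval_one, integral_const, if_true,
    smul_eq_mul, mul_one] at h
  exact ⟨by rwa [measureReal_def, ENNReal.toReal_eq_one_iff] at h⟩

theorem isBounded_support_of_ae_mem_Icc {μ : Measure ℝ} {a b : ℝ}
    (h : ∀ᵐ x ∂μ, x ∈ Set.Icc a b) : Bornology.IsBounded μ.support :=
  (Metric.isBounded_Icc a b).subset (Measure.support_subset_of_isClosed isClosed_Icc h)

theorem semicircleLaw_mem_boundedProb : semicircleLaw ∈ BoundedProb :=
  ⟨inferInstance, isBounded_support_of_ae_mem_Icc semicircleLaw_ae_mem_Icc⟩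

/-! ### The Kesten–McKay distribution for `q ≥ 2` -/

/-- The density of the Kesten–McKay distribution with respect to the semicircle law. -/
noncomputable def kestenMcKayDensity (q : ℕ) (x : ℝ) : ℝ :=
  (q + 1) / ((q + 1) ^ 2 / q - x ^ 2)

/-- The Kesten–McKay distribution, for `q ≥ 2`. -/
noncomputable def kestenMcKay (q : ℕ) : Measure ℝ :=
  semicircleLaw.withDensity fun x => ENNReal.ofReal (kestenMcKayDensity q x)

/-- The lower bound equals `(q-1)²/q`; it vanishes at `q = 1`, which is why that case is treated
apart. -/
theorem kestenMcKay_denom_pos {q : ℕ} (hq : 2 ≤ q) {x : ℝ} (hx : x ∈ Set.Icc (-2 : ℝ) 2) :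
    0 < ((q : ℝ) + 1) ^ 2 / q - 4 ∧
      ((q : ℝ) + 1) ^ 2 / q - 4 ≤ ((q : ℝ) + 1) ^ 2 / q - x ^ 2 := by
  have hq' : (2 : ℝ) ≤ q := by exact_mod_cast hq
  have h1 : 0 < ((q : ℝ) + 1) ^ 2 / q - 4 := by
    rw [sub_pos, lt_div_iff₀ (by linarith)]
    nlinarith
  exact ⟨h1, by nlinarith [hx.1, hx.2]⟩

theorem kestenMcKayDensity_nonneg {q : ℕ} (hq : 2 ≤ q) {x : ℝ} (hx : x ∈ Set.Icc (-2 : ℝ) 2) :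
    0 ≤ kestenMcKayDensity q x := by
  have := kestenMcKay_denom_pos hq hx
  exact div_nonneg (by positivity) (by linarith)

theorem measurable_kestenMcKayDensity (q : ℕ) : Measurable (kestenMcKayDensity q) := by
  unfold kestenMcKayDensity
  fun_prop

theorem continuousOn_kestenMcKayDensity {q : ℕ} (hq : 2 ≤ q) :
    ContinuousOn (kestenMcKayDensity q) (Set.Icc (-2) 2) := by
  unfold kestenMcKayDensity
  refine ContinuousOn.div (by fun_prop) (by fun_prop) fun x hx => ?_
  have := kestenMcKay_denom_pos hq hx
  linarith

theorem integral_kestenMcKay {q : ℕ} (hq : 2 ≤ q) (f : ℝ → ℝ) :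
    ∫ x, f x ∂kestenMcKay q = ∫ x, f x * kestenMcKayDensity q x ∂semicircleLaw := by
  rw [kestenMcKay, integral_withDensity_eq_integral_toReal_smul
    (measurable_kestenMcKayDensity q).ennreal_ofReal (by simp)]
  refine integral_congr_ae ?_
  filter_upwards [semicircleLaw_ae_mem_Icc] with x hx
  rw [ENNReal.toReal_ofReal (kestenMcKayDensity_nonneg hq hx), smul_eq_mul, mul_comm]

theorem kestenMcKay_ae_mem_Icc (q : ℕ) : ∀ᵐ x ∂kestenMcKay q, x ∈ Set.Icc (-2 : ℝ) 2 :=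
  (withDensity_absolutelyContinuous _ _).ae_le semicircleLaw_ae_mem_Icc

theorem isFiniteMeasure_kestenMcKay {q : ℕ} (hq : 2 ≤ q) : IsFiniteMeasure (kestenMcKay q) :=
  isFiniteMeasure_withDensity_ofReal
    (continuousOn_kestenMcKayDensity hq).integrable_semicircleLaw.hasFiniteIntegral

instance : IsFiniteMeasure Polynomial.Chebyshev.measureT := by
  have h := Polynomial.Chebyshev.integrable_measureT (f := fun _ => 1) continuousOn_const
  simpa [integrable_const_iff] using h

theorem Polynomial.Chebyshev.measureT_ae_mem_Icc :
    ∀ᵐ x ∂Polynomial.Chebyshev.measureT, x ∈ Set.Icc (-1 : ℝ) 1 := by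
  rw [measureT]
  exact (ae_restrict_mem measurableSet_Ioc).mono fun x hx => Set.Ioc_subset_Icc_self hx

/-- The `S_n` are not uniformly bounded on `[-2, 2]`, but the semicircle weight compensates: `(1-x²)
S_n(2x)` is half a difference of two `T`'s, hence at most 1 in absolute value. -/
theorem exists_forall_abs_integral_S_kestenMcKay_le {q : ℕ} (hq : 2 ≤ q) :
    ∃ K, ∀ n : ℤ, |∫ x, (Polynomial.Chebyshev.S ℝ n).eval x ∂kestenMcKay q| ≤ K := by
  refine ⟨2 / Real.pi * ((q + 1) / (((q : ℝ) + 1) ^ 2 / q - 4) *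
    Polynomial.Chebyshev.measureT.real Set.univ), fun n => ?_⟩
  rw [integral_kestenMcKay hq, integral_semicircleLaw, abs_mul,
    abs_of_nonneg (by positivity : 0 ≤ 2 / Real.pi)]
  refine mul_le_mul_of_nonneg_left ?_ (by positivity)
  rw [← Real.norm_eq_abs]
  refine norm_integral_le_of_norm_le_const ?_
  filter_upwards [Polynomial.Chebyshev.measureT_ae_mem_Icc] with x hx
  have hx2 : 2 * x ∈ Set.Icc (-2 : ℝ) 2 := ⟨by linarith [hx.1], by linarith [hx.2]⟩
  have hd := kestenMcKay_denom_pos hq hx2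
  rw [← mul_assoc, Polynomial.Chebyshev.one_sub_sq_mul_eval_S, norm_mul,
    Real.norm_of_nonneg (kestenMcKayDensity_nonneg hq hx2)]
  have hT : ∀ m : ℤ, |(Polynomial.Chebyshev.T ℝ m).eval x| ≤ 1 := fun m =>
    Polynomial.Chebyshev.abs_eval_T_real_le_one m (abs_le.2 hx)
  have h1 : ‖((Polynomial.Chebyshev.T ℝ n).eval x - (Polynomial.Chebyshev.T ℝ (n + 2)).eval x) / 2‖
      ≤ 1 := by
    rw [Real.norm_eq_abs, abs_le]
    have h1 := abs_le.1 (hT n)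
    have h2 := abs_le.1 (hT (n + 2))
    constructor <;> linarith
  have h2 : kestenMcKayDensity q (2 * x) ≤ (q + 1) / (((q : ℝ) + 1) ^ 2 / q - 4) :=
    div_le_div_of_nonneg_left (by positivity) hd.1 hd.2
  calc _ ≤ 1 * kestenMcKayDensity q (2 * x) := by
        gcongr
        exact kestenMcKayDensity_nonneg hq hx2
    _ ≤ _ := by rwa [one_mul]

theorem integrable_kestenMcKay {q : ℕ} (hq : 2 ≤ q) (P : Polynomial ℝ) :
    Integrable (fun x => P.eval x) (kestenMcKay q) := by
  have := isFiniteMeasure_kestenMcKay hq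
  have h := P.continuous.continuousOn.integrableOn_compact (μ := kestenMcKay q)
    (isCompact_Icc (a := -2) (b := 2))
  rwa [IntegrableOn, Measure.restrict_eq_self_of_ae_mem (kestenMcKay_ae_mem_Icc q)] at h

/-- Multiplying `S_n` by the denominator of the density gives `(q + q⁻¹) S_n - S_{n+2} - S_{n-2}`.
The denominator cancels in the integral, leaving `q + 1` times a semicircle integral of `S_n`. -/
theorem integral_S_kestenMcKay_recurrence {q : ℕ} (hq : 2 ≤ q) {n : ℤ} (hn : 0 ≤ n) :
    (q + (q : ℝ)⁻¹) * ∫ x, (Polynomial.Chebyshev.S ℝ n).eval x ∂kestenMcKay q =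
      ∫ x, (Polynomial.Chebyshev.S ℝ (n + 2)).eval x ∂kestenMcKay q +
      ∫ x, (Polynomial.Chebyshev.S ℝ (n - 2)).eval x ∂kestenMcKay q +
      if n = 0 then (q + 1 : ℝ) else 0 := by
  have hq0 : (q : ℝ) ≠ 0 := by positivity
  have h1 : ∫ x, ((q + (q : ℝ)⁻¹) * (Polynomial.Chebyshev.S ℝ n).eval x -
      (Polynomial.Chebyshev.S ℝ (n + 2)).eval x - (Polynomial.Chebyshev.S ℝ (n - 2)).eval x)
      ∂kestenMcKay q = if n = 0 then (q + 1 : ℝ) else 0 := by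
    rw [integral_kestenMcKay hq]
    have h2 : ∫ x, (q + 1) * (Polynomial.Chebyshev.S ℝ n).eval x ∂semicircleLaw =
        if n = 0 then (q + 1 : ℝ) else 0 := by
      rw [integral_const_mul, integral_S_semicircleLaw hn]
      simp
    rw [← h2]
    refine integral_congr_ae ?_
    filter_upwards [semicircleLaw_ae_mem_Icc] with x hx
    have hd := kestenMcKay_denom_pos hq hx
    have e1 := congrArg (Polynomial.eval x) (Polynomial.Chebyshev.S_add_two ℝ n)
    have e2 := congrArg (Polynomial.eval x) (Polynomial.Chebyshev.S_sub_two ℝ n)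
    have e3 := congrArg (Polynomial.eval x) (Polynomial.Chebyshev.S_add_one ℝ n)
    simp only [Polynomial.eval_mul, Polynomial.eval_sub, Polynomial.eval_X] at e1 e2 e3
    have e4 : (q + (q : ℝ)⁻¹) * (Polynomial.Chebyshev.S ℝ n).eval x -
      (Polynomial.Chebyshev.S ℝ (n + 2)).eval x - (Polynomial.Chebyshev.S ℝ (n - 2)).eval x =
      (((q : ℝ) + 1) ^ 2 / q - x ^ 2) * (Polynomial.Chebyshev.S ℝ n).eval x := by
      have e5 : ((q : ℝ) + 1) ^ 2 / q = q + (q : ℝ)⁻¹ + 2 := by field_simp; ring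
      rw [e5]
      linear_combination -e1 - e2 - x * e3
    rw [e4, kestenMcKayDensity]
    have : ((q : ℝ) + 1) ^ 2 / q - x ^ 2 ≠ 0 := by linarith
    rw [mul_div_assoc', div_eq_iff this]
    ring
  rw [integral_sub, integral_sub, integral_const_mul] at h1
  · linear_combination h1
  · exact (integrable_kestenMcKay hq _).const_mul _
  · exact integrable_kestenMcKay hq _
  · exact ((integrable_kestenMcKay hq _).const_mul _).sub (integrable_kestenMcKay hq _)
  · exact integrable_kestenMcKay hq _

theorem eq_zero_of_bounded_of_add_two_eq_mul {b : ℤ → ℝ} {c K : ℝ} (hc : 1 < c)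
    (hK : ∀ n, |b n| ≤ K) (hb : ∀ n, 1 ≤ n → b (n + 2) = c * b n) {n : ℤ} (hn : 1 ≤ n) :
    b n = 0 := by
  have h : ∀ k : ℕ, b (n + 2 * k) = c ^ k * b n := by
    intro k
    induction k with
    | zero => simp
    | succ k ih =>
      push_cast
      rw [mul_add, ← add_assoc, mul_one, hb _ (by omega), ih, pow_succ]
      ring
  by_contra hne
  have hpos := abs_pos.2 hne
  obtain ⟨k, hk⟩ := pow_unbounded_of_one_lt (K / |b n|) hc
  rw [div_lt_iff₀ hpos] at hk
  have := hK (n + 2 * k)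
  rw [h, abs_mul, abs_of_nonneg (by positivity)] at this
  linarith

/-- The recurrence says that `b n = M n - q⁻¹ M (n-2)` satisfies `b (n+2) = q b n`. Since `M` is
bounded, this geometric growth forces `b = 0`. -/
theorem integral_S_kestenMcKay_eq {q : ℕ} (hq : 2 ≤ q) {n : ℤ} (hn : 1 ≤ n) :
    ∫ x, (Polynomial.Chebyshev.S ℝ n).eval x ∂kestenMcKay q =
      (q : ℝ)⁻¹ * ∫ x, (Polynomial.Chebyshev.S ℝ (n - 2)).eval x ∂kestenMcKay q := by
  set M : ℤ → ℝ := fun n => ∫ x, (Polynomial.Chebyshev.S ℝ n).eval x ∂kestenMcKay q with hM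
  have hq' : (2 : ℝ) ≤ q := by exact_mod_cast hq
  have hq0 : (q : ℝ) * (q : ℝ)⁻¹ = 1 := mul_inv_cancel₀ (by linarith)
  obtain ⟨K, hK⟩ := exists_forall_abs_integral_S_kestenMcKay_le hq
  have := eq_zero_of_bounded_of_add_two_eq_mul (b := fun n => M n - (q : ℝ)⁻¹ * M (n - 2))
    (c := q) (K := K + (q : ℝ)⁻¹ * K) (by linarith) (fun n => ?_) (fun n hn => ?_) hn
  · exact sub_eq_zero.1 this
  · refine (abs_sub _ _).trans (add_le_add (hK n) ?_)
    rw [abs_mul, abs_of_nonneg (by positivity)]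
    exact mul_le_mul_of_nonneg_left (hK _) (by positivity)
  · have h := integral_S_kestenMcKay_recurrence hq (n := n) (by omega)
    rw [if_neg (by omega)] at h
    change (q + (q : ℝ)⁻¹) * M n = M (n + 2) + M (n - 2) + 0 at h
    simp only [add_sub_cancel_right]
    linear_combination -h + M (n - 2) * hq0

theorem kestenMcKay_univ {q : ℕ} (hq : 2 ≤ q) : (kestenMcKay q).real Set.univ = 1 := by
  have h0 := integral_S_kestenMcKay_recurrence hq (n := 0) le_rfl
  have h2 := integral_S_kestenMcKay_eq hq (n := 2) (by norm_num)
  have hq' : (2 : ℝ) ≤ q := by exact_mod_cast hq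
  -- As `S_{-2} = -1`, the recurrence at `n = 0` becomes a linear equation for the total mass.
  rw [zero_add, h2] at h0
  simp only [sub_self, zero_sub, Polynomial.Chebyshev.S_neg_two, Polynomial.Chebyshev.S_zero,
    Polynomial.eval_one, Polynomial.eval_neg, integral_neg, integral_const, smul_eq_mul,
    mul_one, if_true] at h0
  have : ((q : ℝ) + 1) * ((kestenMcKay q).real Set.univ - 1) = 0 := by linear_combination h0
  rcases mul_eq_zero.1 this with h | h <;> linarith

theorem isProbabilityMeasure_kestenMcKay {q : ℕ} (hq : 2 ≤ q) :
    IsProbabilityMeasure (kestenMcKay q) := by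
  have h := kestenMcKay_univ hq
  exact ⟨by rwa [measureReal_def, ENNReal.toReal_eq_one_iff] at h⟩

theorem integral_sphericalPoly_kestenMcKay {q : ℕ} (hq : 2 ≤ q) (n : ℕ) :
    ∫ x, (sphericalPoly q n).eval x ∂kestenMcKay q = if n = 0 then 1 else 0 := by
  match n with
  | 0 => simp [sphericalPoly, kestenMcKay_univ hq]
  | n + 1 =>
    simp only [sphericalPoly, Polynomial.eval_sub, Polynomial.eval_mul, Polynomial.eval_C]
    rw [integral_sub (integrable_kestenMcKay hq _) ((integrable_kestenMcKay hq _).const_mul _),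
      integral_const_mul, integral_S_kestenMcKay_eq hq (by omega),
      show (n : ℤ) + 1 - 2 = n - 1 by ring]
    simp

/-! ### The arcsine law, for `q = 1` -/

/-- The arcsine law on `[-2, 2]`: the Kesten–McKay distribution for `q = 1`. -/
noncomputable def arcsineLaw : Measure ℝ :=
  (ENNReal.ofReal Real.pi⁻¹ • Polynomial.Chebyshev.measureT).map fun x => 2 * x

theorem integral_arcsineLaw {f : ℝ → ℝ} (hf : Continuous f) :
    ∫ x, f x ∂arcsineLaw = Real.pi⁻¹ * ∫ x, f (2 * x) ∂Polynomial.Chebyshev.measureT := by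
  rw [arcsineLaw, integral_map (by fun_prop) hf.aestronglyMeasurable, integral_smul_measure,
    ENNReal.toReal_ofReal (by positivity), smul_eq_mul]

theorem integral_sphericalPoly_arcsineLaw (n : ℕ) :
    ∫ x, (sphericalPoly 1 n).eval x ∂arcsineLaw = if n = 0 then 1 else 0 := by
  rw [integral_arcsineLaw (Polynomial.continuous _)]
  have hpi := Real.pi_ne_zero
  match n with
  | 0 =>
    have := Polynomial.Chebyshev.integral_eval_T_real_measureT_zero
    simp only [Polynomial.Chebyshev.T_zero] at this
    simp only [sphericalPoly, Polynomial.eval_one] at this ⊢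
    rw [this, inv_mul_cancel₀ hpi, if_pos trivial]
  | n + 1 =>
    -- For `q = 1` the spherical polynomials are rescaled `T_n`, through `2 T_n = U_n - U_{n-2}`.
    have h : ∀ x : ℝ, (sphericalPoly 1 (n + 1)).eval (2 * x) =
        2 * (Polynomial.Chebyshev.T ℝ (n + 1)).eval x := by
      intro x
      have h1 := congrArg (Polynomial.eval x) (Polynomial.Chebyshev.two_mul_T_eq_U_sub_U ℝ (n - 1))
      rw [← Polynomial.Chebyshev.S_comp_two_mul_X, ← Polynomial.Chebyshev.S_comp_two_mul_X,
        show (n : ℤ) - 1 + 2 = n + 1 by ring] at h1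
      simp only [Polynomial.eval_mul, Polynomial.eval_sub, Polynomial.eval_comp,
        Polynomial.eval_X, Polynomial.eval_ofNat] at h1
      rw [h1]
      simp [sphericalPoly]
    simp_rw [h]
    rw [integral_const_mul,
      Polynomial.Chebyshev.integral_eval_T_real_measureT_of_ne_zero (by omega)]
    simp

theorem arcsineLaw_ae_mem_Icc : ∀ᵐ x ∂arcsineLaw, x ∈ Set.Icc (-2 : ℝ) 2 := by
  rw [arcsineLaw, ae_map_iff (p := (· ∈ Set.Icc (-2 : ℝ) 2)) (by fun_prop) measurableSet_Icc]
  refine Measure.ae_smul_measure ?_ _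
  filter_upwards [Polynomial.Chebyshev.measureT_ae_mem_Icc] with x hx
  exact ⟨by linarith [hx.1], by linarith [hx.2]⟩

instance : IsProbabilityMeasure arcsineLaw := by
  have h := integral_sphericalPoly_arcsineLaw 0
  simp only [sphericalPoly, Polynomial.eval_one, integral_const, if_true, smul_eq_mul,
    mul_one] at h
  exact ⟨by rwa [measureReal_def, ENNReal.toReal_eq_one_iff] at h⟩

/-! ### Moment determinacy and identification of the spectral measure -/

theorem exists_forall_ae_mem_Icc_of_mem_boundedProb {μ : Measure ℝ} (hμ : μ ∈ BoundedProb) :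
    ∃ R : ℝ, ∀ R', R ≤ R' → ∀ᵐ x ∂μ, x ∈ Set.Icc (-R') R' := by
  obtain ⟨R, hR⟩ := hμ.2.subset_closedBall 0
  refine ⟨R, fun R' h => ?_⟩
  filter_upwards [Measure.support_mem_ae (μ := μ)] with x hx
  have := hR hx
  rw [Real.closedBall_eq_Icc] at this
  exact ⟨by linarith [this.1], by linarith [this.2]⟩

theorem Continuous.integrable_of_ae_mem_Icc {μ : Measure ℝ} [IsFiniteMeasure μ] {a b : ℝ}
    (h : ∀ᵐ x ∂μ, x ∈ Set.Icc a b) {f : ℝ → ℝ} (hf : Continuous f) : Integrable f μ := by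
  have h2 := hf.continuousOn.integrableOn_compact (μ := μ) (isCompact_Icc (a := a) (b := b))
  rwa [IntegrableOn, Measure.restrict_eq_self_of_ae_mem h] at h2

theorem Continuous.integrable_of_mem_boundedProb {μ : Measure ℝ} (hμ : μ ∈ BoundedProb)
    {f : ℝ → ℝ} (hf : Continuous f) : Integrable f μ := by
  have := hμ.1
  obtain ⟨R, hR⟩ := exists_forall_ae_mem_Icc_of_mem_boundedProb hμ
  exact hf.integrable_of_ae_mem_Icc (hR R le_rfl)

/-- A probability measure of bounded support is determined by its moments. -/
theorem eq_of_forall_integral_polynomial_eq {μ ν : Measure ℝ} (hμ : μ ∈ BoundedProb)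
    (hν : ν ∈ BoundedProb)
    (h : ∀ P : Polynomial ℝ, ∫ x, P.eval x ∂μ = ∫ x, P.eval x ∂ν) : μ = ν := by
  have := hμ.1
  have := hν.1
  obtain ⟨R₁, hR₁⟩ := exists_forall_ae_mem_Icc_of_mem_boundedProb hμ
  obtain ⟨R₂, hR₂⟩ := exists_forall_ae_mem_Icc_of_mem_boundedProb hν
  set R := max R₁ R₂
  refine ext_of_forall_integral_eq_of_IsFiniteMeasure fun f => ?_
  refine eq_of_forall_dist_le fun ε hε => ?_
  -- Weierstrass approximation on an interval carrying both measures.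
  obtain ⟨P, hP⟩ := exists_polynomial_near_of_continuousOn (-R) R f f.continuous.continuousOn
    (ε / 2) (by positivity)
  have key : ∀ ρ : Measure ℝ, ρ ∈ BoundedProb → (∀ᵐ x ∂ρ, x ∈ Set.Icc (-R) R) →
      |∫ x, P.eval x ∂ρ - ∫ x, f x ∂ρ| ≤ ε / 2 := by
    intro ρ hρ hs
    have := hρ.1
    rw [← integral_sub (P.continuous.integrable_of_mem_boundedProb hρ)
      (f.continuous.integrable_of_mem_boundedProb hρ), ← Real.norm_eq_abs]
    refine (norm_integral_le_of_norm_le_const (C := ε / 2) ?_).trans (by simp)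
    filter_upwards [hs] with x hx using (hP x hx).le
  have h1 := abs_le.1 (key μ hμ (hR₁ R (le_max_left _ _)))
  have h2 := abs_le.1 (key ν hν (hR₂ R (le_max_right _ _)))
  rw [h P] at h1
  rw [Real.dist_eq, abs_le]
  constructor <;> linarith

/-- Integration of polynomials against a probability measure of bounded support. -/
noncomputable def integralₗ {μ : Measure ℝ} (hμ : μ ∈ BoundedProb) : Polynomial ℝ →ₗ[ℝ] ℝ where
  toFun P := ∫ x, P.eval x ∂μ
  map_add' P Q := by
    simp only [Polynomial.eval_add]
    exact integral_add (P.continuous.integrable_of_mem_boundedProb hμ)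
      (Q.continuous.integrable_of_mem_boundedProb hμ)
  map_smul' c P := by
    simp only [Polynomial.eval_smul, smul_eq_mul, RingHom.id_apply, integral_const_mul]

theorem isSpectralMeasure_of_integral_sphericalPoly {V : Type*} {G : SimpleGraph V}
    [G.LocallyFinite] (hG : G.IsTree) {q : ℕ} (hq : 1 ≤ q)
    (hreg : G.IsRegularOfDegree (q + 1)) (o : V) {μ : Measure ℝ} (hμ : μ ∈ BoundedProb)
    (h : ∀ n, ∫ x, (sphericalPoly q n).eval x ∂μ = if n = 0 then 1 else 0) :
    IsSpectralMeasure G q o μ := by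
  refine ⟨hμ, fun P => ?_⟩
  have : integralₗ hμ = vertexStateₗ G q o := linearMap_ext_sphericalPoly q fun n =>
    (h n).trans (vertexState_sphericalPoly hG hq hreg o n).symm
  exact LinearMap.congr_fun this P

theorem isSpectralMeasure_kestenMcKay {V : Type*} {G : SimpleGraph V}
    [G.LocallyFinite] (hG : G.IsTree) {q : ℕ} (hq : 2 ≤ q)
    (hreg : G.IsRegularOfDegree (q + 1)) (o : V) : IsSpectralMeasure G q o (kestenMcKay q) :=
  isSpectralMeasure_of_integral_sphericalPoly hG (by omega) hreg o
    ⟨isProbabilityMeasure_kestenMcKay hq, isBounded_support_of_ae_mem_Icc (kestenMcKay_ae_mem_Icc q)⟩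
    (integral_sphericalPoly_kestenMcKay hq)

theorem IsSpectralMeasure.eq {V : Type*} {G : SimpleGraph V} [G.LocallyFinite] {q : ℕ} {o : V}
    {μ ν : Measure ℝ} (hμ : IsSpectralMeasure G q o μ) (hν : IsSpectralMeasure G q o ν) : μ = ν :=
  eq_of_forall_integral_polynomial_eq hμ.1 hν.1 fun P => (hμ.2 P).trans (hν.2 P).symm

theorem existsUnique_isSpectralMeasure {V : Type*} {G : SimpleGraph V}
    [G.LocallyFinite] (hG : G.IsTree) {q : ℕ} (hq : 1 ≤ q)
    (hreg : G.IsRegularOfDegree (q + 1)) (o : V) : ∃! μ : Measure ℝ, IsSpectralMeasure G q o μ := by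
  refine existsUnique_of_exists_of_unique ?_ fun μ ν => IsSpectralMeasure.eq
  rcases hq.eq_or_lt with rfl | hq
  · exact ⟨arcsineLaw, isSpectralMeasure_of_integral_sphericalPoly hG le_rfl hreg o
      ⟨inferInstance, isBounded_support_of_ae_mem_Icc arcsineLaw_ae_mem_Icc⟩
      integral_sphericalPoly_arcsineLaw⟩
  · exact ⟨_, isSpectralMeasure_kestenMcKay hG hq hreg o⟩

theorem isSpectralMeasure_spectralMeasure {V : Type*} {G : SimpleGraph V}
    [G.LocallyFinite] (hG : G.IsTree) {q : ℕ} (hq : 1 ≤ q)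
    (hreg : G.IsRegularOfDegree (q + 1)) (o : V) :
    IsSpectralMeasure G q o (spectralMeasure G q o) := by
  have h := (existsUnique_isSpectralMeasure hG hq hreg o).exists
  rw [spectralMeasure, dif_pos h]
  exact h.choose_spec

theorem spectralMeasure_eq_kestenMcKay {V : Type*} {G : SimpleGraph V}
    [G.LocallyFinite] (hG : G.IsTree) {q : ℕ} (hq : 2 ≤ q)
    (hreg : G.IsRegularOfDegree (q + 1)) (o : V) : spectralMeasure G q o = kestenMcKay q :=
  (isSpectralMeasure_spectralMeasure hG (by omega) hreg o).eq
    (isSpectralMeasure_kestenMcKay hG hq hreg o)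

/-! ### Quantile functions and the quantile coupling -/

section Quantile

variable {μ ν : Measure ℝ}

theorem monotone_measureReal_Iic [IsFiniteMeasure μ] : Monotone fun y => μ.real (Set.Iic y) :=
  fun _ _ h => measureReal_mono (Set.Iic_subset_Iic.2 h)

/-- The infimum is attained because distribution functions are right-continuous. Restricting to `0 <
x < 1` makes the set nonempty and bounded below, so `sInf` is not a default value. -/
theorem inverseDistribution_le_iff [IsProbabilityMeasure μ] {x : ℝ} (hx : x ∈ Set.Ioo (0 : ℝ) 1)
    {y : ℝ} : inverseDistribution μ x ≤ y ↔ x ≤ μ.real (Set.Iic y) := by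
  have hcdf : ∀ z, μ.real (Set.Iic z) = ProbabilityTheory.cdf μ z := fun z =>
    (ProbabilityTheory.cdf_eq_real μ z).symm
  have hbdd : BddBelow {y : ℝ | x ≤ μ.real (Set.Iic y)} := by
    obtain ⟨z, hz⟩ := ((ProbabilityTheory.tendsto_cdf_atBot μ).eventually_lt_const hx.1).exists
    refine ⟨z, fun w hw => le_of_not_gt fun hwz => ?_⟩
    have h1 : x ≤ μ.real (Set.Iic w) := hw
    have h2 := monotone_measureReal_Iic (μ := μ) hwz.le
    simp only [hcdf] at h1 h2
    linarith
  have hne : {y : ℝ | x ≤ μ.real (Set.Iic y)}.Nonempty := by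
    obtain ⟨z, hz⟩ := ((ProbabilityTheory.tendsto_cdf_atTop μ).eventually_const_lt hx.2).exists
    exact ⟨z, by rw [Set.mem_ofPred_eq, hcdf]; exact hz.le⟩
  refine ⟨fun h => ?_, fun h => csInf_le hbdd h⟩
  have h1 : ∀ z, y < z → x ≤ ProbabilityTheory.cdf μ z := by
    intro z hz
    obtain ⟨w, hw, hwz⟩ := exists_lt_of_csInf_lt hne (h.trans_lt hz)
    rw [← hcdf]
    exact le_trans hw (monotone_measureReal_Iic hwz.le)
  have h2 := (ProbabilityTheory.cdf μ).right_continuous y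
  rw [hcdf]
  refine ge_of_tendsto (h2.mono_left (nhdsWithin_mono y Set.Ioi_subset_Ici_self)) ?_
  filter_upwards [self_mem_nhdsWithin] with z hz using h1 z hz

theorem monotoneOn_inverseDistribution [IsProbabilityMeasure μ] :
    MonotoneOn (inverseDistribution μ) (Set.Ioo 0 1) := fun x hx x' hx' h => by
  rw [inverseDistribution_le_iff hx]
  exact h.trans ((inverseDistribution_le_iff hx').1 le_rfl)

theorem aemeasurable_inverseDistribution [IsProbabilityMeasure μ] :
    AEMeasurable (inverseDistribution μ) (volume.restrict (Set.Ioo 0 1)) :=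
  aemeasurable_restrict_of_monotoneOn measurableSet_Ioo monotoneOn_inverseDistribution

/-- By the Galois connection, the preimage of `(-∞, y]` in `(0, 1)` consists of the `x ≤ μ((-∞,
y])`, a set of length `μ((-∞, y])`. -/
theorem map_inverseDistribution [IsProbabilityMeasure μ] :
    (volume.restrict (Set.Ioo 0 1)).map (inverseDistribution μ) = μ := by
  have : IsFiniteMeasure ((volume.restrict (Set.Ioo 0 1)).map (inverseDistribution μ)) :=
    Measure.isFiniteMeasure_map _ _
  refine Measure.ext_of_Iic _ _ fun y => ?_
  rw [Measure.map_apply_of_aemeasurable aemeasurable_inverseDistribution measurableSet_Iic,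
    Measure.restrict_apply₀' measurableSet_Ioo.nullMeasurableSet]
  have hset : inverseDistribution μ ⁻¹' Set.Iic y ∩ Set.Ioo 0 1 =
      Set.Iic (μ.real (Set.Iic y)) ∩ Set.Ioo 0 1 := by
    ext x
    simp only [Set.mem_inter_iff, Set.mem_preimage, Set.mem_Iic]
    exact and_congr_left fun hx => inverseDistribution_le_iff hx
  have h0 : 0 ≤ μ.real (Set.Iic y) := measureReal_nonneg
  have h1 : μ.real (Set.Iic y) ≤ 1 := measureReal_le_one
  have hae : (Set.Iic (μ.real (Set.Iic y)) ∩ Set.Ioo 0 1 : Set ℝ) =ᵐ[volume]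
      (Set.Iic (μ.real (Set.Iic y)) ∩ Set.Ioc 0 1 : Set ℝ) :=
    (ae_eq_refl _).inter Ioo_ae_eq_Ioc
  rw [hset, measure_congr hae, Set.inter_comm, Set.Ioc_inter_Iic, min_eq_right h1,
    Real.volume_Ioc, sub_zero, ofReal_measureReal]

/-- The quantile coupling bounds `W_∞` by the uniform distance of the quantile functions. -/
theorem wassersteinInfty_le_of_inverseDistribution [IsProbabilityMeasure μ]
    [IsProbabilityMeasure ν] {δ : ℝ}
    (h : ∀ x ∈ Set.Ioo (0 : ℝ) 1, |inverseDistribution μ x - inverseDistribution ν x| ≤ δ) :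
    wassersteinInfty μ ν ≤ ENNReal.ofReal δ := by
  have hm := (aemeasurable_inverseDistribution (μ := μ)).prodMk
    (aemeasurable_inverseDistribution (μ := ν))
  refine (iInf₂_le ((volume.restrict (Set.Ioo 0 1)).map fun x =>
    (inverseDistribution μ x, inverseDistribution ν x)) ⟨?_, ?_⟩).trans ?_
  rotate_left
  · rw [AEMeasurable.map_map_of_aemeasurable measurable_fst.aemeasurable hm]
    exact map_inverseDistribution
  · rw [AEMeasurable.map_map_of_aemeasurable measurable_snd.aemeasurable hm]
    exact map_inverseDistribution
  · rw [eLpNorm_exponent_top]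
    refine eLpNormEssSup_le_of_ae_bound ?_
    rw [ae_map_iff hm (measurableSet_le (by fun_prop) measurable_const)]
    filter_upwards [ae_restrict_mem measurableSet_Ioo] with x hx using h x hx

theorem measureReal_Iic_eq_one [IsProbabilityMeasure μ] {a b y : ℝ}
    (h : ∀ᵐ x ∂μ, x ∈ Set.Icc a b) (hy : b ≤ y) : μ.real (Set.Iic y) = 1 := by
  have : ∀ᵐ x ∂μ, x ∈ Set.Iic y := h.mono fun x hx => hx.2.trans hy
  rw [measureReal_def, prob_compl_eq_zero_iff measurableSet_Iic |>.1 this, ENNReal.toReal_one]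

theorem le_inverseDistribution [IsProbabilityMeasure μ] {a b : ℝ}
    (h : ∀ᵐ x ∂μ, x ∈ Set.Icc a b) {x : ℝ} (hx : x ∈ Set.Ioo (0 : ℝ) 1) :
    a ≤ inverseDistribution μ x := by
  by_contra! hlt
  have h1 := (inverseDistribution_le_iff (μ := μ) hx).1 le_rfl
  have h2 : μ (Set.Iic (inverseDistribution μ x)) = 0 := by
    have h3 : Set.Iic (inverseDistribution μ x) ⊆ {z | z ∈ Set.Icc a b}ᶜ := fun z hz hz' =>
      absurd (le_trans hz'.1 hz) (not_le.2 hlt)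
    exact measure_mono_null h3 h
  rw [measureReal_def, h2, ENNReal.toReal_zero] at h1
  linarith [hx.1]

/-- If `ν` charges every interval of length `δ` by at least `m`, and the distribution functions
of `μ` and `ν` differ by at most `m`, then the quantile functions differ by at most `δ`. -/
theorem abs_inverseDistribution_sub_le [IsProbabilityMeasure μ] [IsProbabilityMeasure ν]
    {a b δ m : ℝ} (hμ : ∀ᵐ x ∂μ, x ∈ Set.Icc a b) (hν : ∀ᵐ x ∂ν, x ∈ Set.Icc a b)
    (hm : ∀ y, a ≤ y → y + δ ≤ b → ν.real (Set.Iic y) + m ≤ ν.real (Set.Iic (y + δ)))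
    (hclose : ∀ y, |μ.real (Set.Iic y) - ν.real (Set.Iic y)| ≤ m) {x : ℝ}
    (hx : x ∈ Set.Ioo (0 : ℝ) 1) :
    |inverseDistribution μ x - inverseDistribution ν x| ≤ δ := by
  have h1 : inverseDistribution μ x ≤ inverseDistribution ν x + δ := by
    rw [inverseDistribution_le_iff hx]
    -- Beyond `b` the distribution function is 1; otherwise the mass `m` that `ν` gains over length
    -- `δ` absorbs the discrepancy. The mass of `ν` also serves in the reverse inequality.
    rcases le_total b (inverseDistribution ν x + δ) with h | h
    · rw [measureReal_Iic_eq_one hμ h]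
      exact hx.2.le
    · have h2 := hm _ (le_inverseDistribution hν hx) h
      have h3 := (inverseDistribution_le_iff (μ := ν) hx).1 le_rfl
      have h4 := (abs_le.1 (hclose (inverseDistribution ν x + δ))).1
      linarith
  have h2 : inverseDistribution ν x ≤ inverseDistribution μ x + δ := by
    rw [inverseDistribution_le_iff hx]
    rcases le_total b (inverseDistribution μ x + δ) with h | h
    · rw [measureReal_Iic_eq_one hν h]
      exact hx.2.le
    · have h2 := hm _ (le_inverseDistribution hμ hx) h
      have h3 := (inverseDistribution_le_iff (μ := μ) hx).1 le_rfl
      have h4 := (abs_le.1 (hclose (inverseDistribution μ x))).2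
      linarith
  rw [abs_le]
  constructor <;> linarith

end Quantile

/-! ### Comparison with the semicircle law and convergence -/

theorem abs_kestenMcKayDensity_sub_one_le {q : ℕ} (hq : 2 ≤ q) {x : ℝ}
    (hx : x ∈ Set.Icc (-2 : ℝ) 2) :
    |kestenMcKayDensity q x - 1| ≤ 20 / q := by
  have hq' : (2 : ℝ) ≤ q := by exact_mod_cast hq
  have hq0 : (0 : ℝ) < q := by linarith
  have hd := kestenMcKay_denom_pos hq hx
  have hx4 : x ^ 2 ≤ 4 := by nlinarith [hx.1, hx.2]
  have hx0 := sq_nonneg x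
  have hD : 0 < ((q : ℝ) + 1) ^ 2 - q * x ^ 2 := by nlinarith
  have e : kestenMcKayDensity q x - 1 =
      (q * x ^ 2 - q - 1) / (((q : ℝ) + 1) ^ 2 - q * x ^ 2) := by
    have h1 : ((q : ℝ) + 1) ^ 2 / q - x ^ 2 = (((q : ℝ) + 1) ^ 2 - q * x ^ 2) / q := by
      field_simp
    rw [kestenMcKayDensity, h1, div_div_eq_mul_div, div_sub_one hD.ne']
    congr 1
    ring
  rw [e, abs_div, abs_of_pos hD, div_le_div_iff₀ hD hq0]
  have h2 : |(q : ℝ) * x ^ 2 - q - 1| ≤ 4 * (q : ℝ) := by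
    rw [abs_le]
    constructor <;> nlinarith
  -- The denominator is at least `(q-1)²`, and `q ≤ 2(q-1)`. With `h2` this gives the bound `16/q`,
  -- so 20 is not sharp.
  have h3 : (q : ℝ) ^ 2 ≤ 4 * (((q : ℝ) + 1) ^ 2 - q * x ^ 2) := by nlinarith
  have h4 := mul_le_mul_of_nonneg_right h2 hq0.le
  nlinarith

theorem abs_kestenMcKay_Iic_sub_le {q : ℕ} (hq : 2 ≤ q) (y : ℝ) :
    |(kestenMcKay q).real (Set.Iic y) - semicircleLaw.real (Set.Iic y)| ≤ 20 / q := by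
  have h1 : (kestenMcKay q).real (Set.Iic y) =
      ∫ x, (Set.Iic y).indicator 1 x * kestenMcKayDensity q x ∂semicircleLaw := by
    rw [← integral_kestenMcKay hq, integral_indicator_one measurableSet_Iic]
  have hc := (continuousOn_kestenMcKayDensity hq).integrable_semicircleLaw
  have e : ∀ x, (Set.Iic y).indicator (1 : ℝ → ℝ) x * kestenMcKayDensity q x =
      (Set.Iic y).indicator (kestenMcKayDensity q) x := fun x => by
    by_cases hx : x ∈ Set.Iic y <;> simp [hx]
  simp_rw [e] at h1
  rw [h1, ← integral_indicator_one measurableSet_Iic, ← integral_sub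
    (hc.indicator measurableSet_Iic) ((integrable_const (1 : ℝ)).indicator (f := 1) measurableSet_Iic),
    ← Real.norm_eq_abs]
  refine (norm_integral_le_of_norm_le_const (C := 20 / q) ?_).trans (by simp)
  filter_upwards [semicircleLaw_ae_mem_Icc] with x hx
  by_cases hxy : x ∈ Set.Iic y
  · simpa [hxy] using abs_kestenMcKayDensity_sub_one_le hq hx
  · simp only [Set.indicator_of_notMem hxy, sub_zero, norm_zero]
    positivity

theorem exists_pos_le_semicircleLaw_Iic_add_sub {δ : ℝ} (hδ : 0 < δ) :
    ∃ m > 0, ∀ y, -2 ≤ y → y + δ ≤ 2 →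
      semicircleLaw.real (Set.Iic y) + m ≤ semicircleLaw.real (Set.Iic (y + δ)) := by
  by_cases hδ4 : δ ≤ 4
  swap
  · exact ⟨1, one_pos, fun y h1 h2 => by linarith⟩
  -- On the middle half of `[y, y + δ]` the distance to `±2` is at least `δ/4`, so `4 - x² ≥ δ/4`
  -- and `κ` bounds the density from below there.
  set κ : ℝ := 1 / (2 * Real.pi) * Real.sqrt (δ / 4) with hκ
  have hκ0 : 0 < κ := by positivity
  refine ⟨κ * (δ / 2), by positivity, fun y h1 h2 => ?_⟩
  have hsub : κ * (δ / 2) ≤ semicircleLaw.real (Set.Icc (y + δ / 4) (y + 3 * δ / 4)) := by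
    rw [measureReal_def, ← ENNReal.ofReal_le_iff_le_toReal (measure_ne_top _ _), semicircleLaw,
      withDensity_apply _ measurableSet_Icc, ENNReal.ofReal_mul hκ0.le]
    calc ENNReal.ofReal κ * ENNReal.ofReal (δ / 2)
        = ENNReal.ofReal κ * volume (Set.Icc (y + δ / 4) (y + 3 * δ / 4)) := by
          rw [Real.volume_Icc]; congr 2; ring
      _ = ∫⁻ x in Set.Icc (y + δ / 4) (y + 3 * δ / 4), ENNReal.ofReal κ := by
          rw [setLIntegral_const]
      _ ≤ _ := by
          refine setLIntegral_mono' measurableSet_Icc fun x hx => ENNReal.ofReal_le_ofReal ?_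
          rw [Set.indicator_of_mem (show x ∈ Set.Icc (-2 : ℝ) 2 from
            ⟨by linarith [hx.1], by linarith [hx.2]⟩)]
          refine mul_le_mul_of_nonneg_left (Real.sqrt_le_sqrt ?_) (by positivity)
          nlinarith [hx.1, hx.2]
  have hunion : semicircleLaw.real (Set.Iic y) +
      semicircleLaw.real (Set.Icc (y + δ / 4) (y + 3 * δ / 4)) ≤
      semicircleLaw.real (Set.Iic (y + δ)) := by
    rw [← measureReal_union _ measurableSet_Icc]
    · refine measureReal_mono (Set.union_subset (Set.Iic_subset_Iic.2 (by linarith)) ?_)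
      exact fun x hx => by
        have := hx.2
        rw [Set.mem_Iic]
        linarith
    · refine Set.disjoint_left.2 fun x hx hx' => ?_
      have h3 := hx'.1
      rw [Set.mem_Iic] at hx
      linarith
  linarith

theorem eventually_abs_inverseDistribution_kestenMcKay_sub_le {δ : ℝ} (hδ : 0 < δ) :
    ∀ᶠ q : ℕ in atTop, ∀ x ∈ Set.Ioo (0 : ℝ) 1,
      |inverseDistribution (kestenMcKay q) x - inverseDistribution semicircleLaw x| ≤ δ := by
  obtain ⟨m, hm0, hm⟩ := exists_pos_le_semicircleLaw_Iic_add_sub hδ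
  have hlim : Tendsto (fun q : ℕ => 20 / (q : ℝ)) atTop (𝓝 0) :=
    tendsto_const_div_atTop_nhds_zero_nat 20
  filter_upwards [hlim.eventually_lt_const hm0, eventually_ge_atTop 2] with q hqm hq x hx
  have := isProbabilityMeasure_kestenMcKay hq
  exact abs_inverseDistribution_sub_le (kestenMcKay_ae_mem_Icc q) semicircleLaw_ae_mem_Icc
    hm (fun y => (abs_kestenMcKay_Iic_sub_le hq y).trans hqm.le) hx

/-- For every family of `(q+1)`-regular trees `T q` with base vertices `o q` (`q ≥ 1`), the
normalized spectral measure `μ_q` of `T q` (the Kesten-McKay distribution) is well defined, and as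
`q → ∞` it converges to the semicircle law in `(P_∞(ℝ), W_∞)`, and the inverse distribution
functions converge uniformly on `(0, 1)`. -/
theorem proposition4p1 (V : ℕ → Type*) (T : (q : ℕ) → SimpleGraph (V q))
    [∀ q, (T q).LocallyFinite]
    (hT : ∀ q, 1 ≤ q → (T q).IsTree)
    (hreg : ∀ q, 1 ≤ q → (T q).IsRegularOfDegree (q + 1))
    (o : (q : ℕ) → V q) :
    (∀ q, 1 ≤ q → ∃! μ : Measure ℝ, IsSpectralMeasure (T q) q (o q) μ) ∧
    ((∀ q, 1 ≤ q → spectralMeasure (T q) q (o q) ∈ BoundedProb) ∧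
      semicircleLaw ∈ BoundedProb ∧
      Tendsto (fun q => wassersteinInfty (spectralMeasure (T q) q (o q)) semicircleLaw)
        atTop (𝓝 0)) ∧
    TendstoUniformlyOn (fun q => inverseDistribution (spectralMeasure (T q) q (o q)))
      (inverseDistribution semicircleLaw) atTop (Set.Ioo 0 1) := by

  have hspec : ∀ᶠ q in atTop, spectralMeasure (T q) q (o q) = kestenMcKay q := by
    filter_upwards [eventually_ge_atTop 2] with q hq
    exact spectralMeasure_eq_kestenMcKay (hT q (by omega)) hq (hreg q (by omega)) (o q)
  refine ⟨fun q hq => existsUnique_isSpectralMeasure (hT q hq) hq (hreg q hq) (o q),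
    ⟨fun q hq => (isSpectralMeasure_spectralMeasure (hT q hq) hq (hreg q hq) (o q)).1,
      semicircleLaw_mem_boundedProb, ?_⟩, ?_⟩
  · rw [ENNReal.tendsto_nhds_zero]
    intro ε hε
    -- Here `ε` may be `∞`, so a finite positive `δ` below it is chosen.
    obtain ⟨δ, hδ, hδε⟩ : ∃ δ : ℝ, 0 < δ ∧ ENNReal.ofReal δ ≤ ε := by
      obtain ⟨r, hr0, hrε⟩ := ENNReal.lt_iff_exists_nnreal_btwn.1 hε
      exact ⟨r, by exact_mod_cast hr0, by rw [ENNReal.ofReal_coe_nnreal]; exact hrε.le⟩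
    filter_upwards [hspec, eventually_abs_inverseDistribution_kestenMcKay_sub_le hδ,
      eventually_ge_atTop 2] with q hq hclose hq2
    have := isProbabilityMeasure_kestenMcKay hq2
    rw [hq]
    exact (wassersteinInfty_le_of_inverseDistribution hclose).trans hδε
  · rw [Metric.tendstoUniformlyOn_iff]
    intro ε hε
    filter_upwards [hspec, eventually_abs_inverseDistribution_kestenMcKay_sub_le (half_pos hε)]
      with q hq hclose x hx
    rw [hq, dist_comm, Real.dist_eq]
    exact (hclose x hx).trans_lt (half_lt_self hε)
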